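/- All Banach spaces are real and nonzero. For a Banach space $X$ let $\mathcal L(X)$ be the Banach algebra of bounded linear operators on $X$, let $\Pi(X)=\{(x,x^*)\in X\times X^* : \|x\|=\|x^*\|=x^*(x)=1\}$, and for $T\in\mathcal L(X)$ let $v(T)=\sup\{|x^*(Tx)| : (x,x^*)\in\Pi(X)\}$ be its numerical radius. Let $\mathcal Z(X)=\{S\in\mathcal L(X) : v(S)=0\}$, and let $\|T+\mathcal Z(X)\|=\inf\{\|T-S\| : S\in\mathcal Z(X)\}$ be the quotient norm on $\mathcal L(X)/\mathcal Z(X)$. The numerical index and the second numerical index of $X$ are $$n(X)=\inf\{v(T) : T\in\mathcal L(X),\ \|T\|=1\},\qquad n'(X)=\inf\{v(T) : T\in\mathcal L(X),\ \|T+\mathcal Z(X)\|=1\}.$$ (1) For every $\theta\in[0,1/2]$ there is a Banach space $X_\theta$ with $n(X_\theta)=0$ and $n'(X_\theta)=\theta$. (2) For $0<\theta\le 1/2$ the space $X_\theta$ can be taken four-dimensional. More precisely, for every $\theta\in(0,1/2]$ there is a two-dimensional Banach space $Y$ with $n(Y)=\theta$, and for every two-dimensional Banach space $Y$ with $n(Y)=\theta$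 the four-dimensional space $X=Y\oplus_\infty\ell_2^2$ (that is, $Y\times\mathbb R^2$ with the norm $\|(y,w)\|=\max\{\|y\|,\|w\|_2\}$) satisfies $n(X)=0$ and $n'(X)=\theta$. -/

import Mathlib

open scoped ENNReal

noncomputable section

section NumericalIndex

variable (X : Type*) [NormedAddCommGroup X] [NormedSpace ℝ X]

/-- The set `Π(X)` of pairs `(x, x*)` in `S_X × S_{X*}` with `x*(x) = 1`. -/
def dualPairs : Set (X × StrongDual ℝ X) :=
  {q | ‖q.1‖ = 1 ∧ ‖q.2‖ = 1 ∧ q.2 q.1 = 1}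

variable {X}

/-- The numerical range `V(T)` of a bounded linear operator. -/
def numRange (T : X →L[ℝ] X) : Set ℝ :=
  {a | ∃ q ∈ dualPairs X, a = q.2 (T q.1)}

/-- The numerical radius `v(T) = sup {|a| : a ∈ V(T)}`. -/
def numRadius (T : X →L[ℝ] X) : ℝ :=
  sSup ((fun a : ℝ => |a|) '' numRange T)

theorem numRange_abs_le (T : X →L[ℝ] X) {a : ℝ} (ha : a ∈ numRange T) : |a| ≤ ‖T‖ := by
  obtain ⟨q, ⟨h1, h2, -⟩, rfl⟩ := ha
  calc |q.2 (T q.1)| ≤ ‖q.2‖ * ‖T q.1‖ := q.2.le_opNorm _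
    _ ≤ ‖q.2‖ * (‖T‖ * ‖q.1‖) := by gcongr; exact T.le_opNorm _
    _ = ‖T‖ := by rw [h1, h2]; ring

theorem numRange_bddAbove (T : X →L[ℝ] X) :
    BddAbove ((fun a : ℝ => |a|) '' numRange T) :=
  ⟨‖T‖, by rintro _ ⟨a, ha, rfl⟩; exact numRange_abs_le T ha⟩

theorem numRadius_eq_zero_iff (T : X →L[ℝ] X) :
    numRadius T = 0 ↔ ∀ q ∈ dualPairs X, q.2 (T q.1) = 0 := by
  constructor
  · intro h q hq
    have hle : |q.2 (T q.1)| ≤ numRadius T :=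
      le_csSup (numRange_bddAbove T) ⟨_, ⟨q, hq, rfl⟩, rfl⟩
    rw [h] at hle
    exact abs_nonpos_iff.mp hle
  · intro h
    apply le_antisymm
    · apply Real.sSup_le _ le_rfl
      rintro _ ⟨a, ⟨q, hq, rfl⟩, rfl⟩
      simp [h q hq]
    · apply Real.sSup_nonneg
      rintro _ ⟨a, -, rfl⟩
      exact abs_nonneg a

variable (X)

/-- The Lie algebra `Z(X) = {S ∈ L(X) : v(S) = 0}` of all skew-hermitian operators,
as a linear subspace of `L(X)`. -/
def lieAlg : Submodule ℝ (X →L[ℝ] X) where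
  carrier := {S | numRadius S = 0}
  zero_mem' := (numRadius_eq_zero_iff _).2 fun q _ => by simp
  add_mem' := by
    intro S T hS hT
    have hS' := (numRadius_eq_zero_iff S).1 hS
    have hT' := (numRadius_eq_zero_iff T).1 hT
    exact (numRadius_eq_zero_iff _).2 fun q hq => by simp [hS' q hq, hT' q hq]
  smul_mem' := by
    intro c S hS
    have hS' := (numRadius_eq_zero_iff S).1 hS
    exact (numRadius_eq_zero_iff _).2 fun q hq => by simp [hS' q hq]

/-- The numerical index `n(X) = inf {v(T) : T ∈ L(X), ‖T‖ = 1}`. -/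
def numIndex : ℝ :=
  sInf {r | ∃ T : X →L[ℝ] X, ‖T‖ = 1 ∧ r = numRadius T}

/-- The second numerical index `n'(X) = inf {v(T) : T ∈ L(X), ‖T + Z(X)‖ = 1}`,
where `‖T + Z(X)‖` is the quotient norm on `L(X) / Z(X)`. -/
def secondNumIndex : ℝ :=
  sInf {r | ∃ T : X →L[ℝ] X,
    ‖(Submodule.Quotient.mk T : (X →L[ℝ] X) ⧸ lieAlg X)‖ = 1 ∧ r = numRadius T}

end NumericalIndex

end

/-! In $X = Y\oplus_\infty H$ with $H$ Euclidean, skew maps of $H$ extended by zero lie in $\mathcal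
Z(X)$, so $n(X)=0$ as soon as a nonzero one exists. When $n(Y)>0$, an operator extended from $Y$
keeps its norm modulo $\mathcal Z(X)$, hence $n'(X)\le n(Y)$ (`IsMSummand.secondNumIndex_le`). For
the converse, subtract from $T$ the skew part of its $H$-block. The $Y$-coordinate of what remains
is at most $v(T)/n(Y)$ by `numIndex_mul_norm_fst_le`. The $H$-coordinate is at most $2v(T)$: one
$v(T)$ from the block $Y\to H$, one from the symmetric part. The two bounds combine exactly when
$n(Y)\le 1/2$.

Planes of every index in $[0,1]$ come from the intermediate value theorem along a path of norms from
Euclidean (index 0) to sup (index 1); continuity is `numIndex_le_add_of_equiv`. For $\theta=0$, an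
$\ell_\infty$-sum of planes with positive indices tending to 0 is used. -/

section Basic

variable {X Y : Type*} [NormedAddCommGroup X] [NormedSpace ℝ X]
  [NormedAddCommGroup Y] [NormedSpace ℝ Y]

/-! ### Numerical radius, M-summands, and continuity of the numerical index. -/

theorem abs_apply_le_numRadius (T : X →L[ℝ] X) {x : X} {f : StrongDual ℝ X}
    (hx : ‖x‖ = 1) (hf : ‖f‖ = 1) (hfx : f x = 1) : |f (T x)| ≤ numRadius T :=
  le_csSup (numRange_bddAbove T) ⟨_, ⟨(x, f), ⟨hx, hf, hfx⟩, rfl⟩, rfl⟩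

theorem numRadius_nonneg (T : X →L[ℝ] X) : 0 ≤ numRadius T := by
  apply Real.sSup_nonneg
  rintro _ ⟨a, -, rfl⟩
  exact abs_nonneg a

theorem numRadius_le {T : X →L[ℝ] X} {c : ℝ} (hc : 0 ≤ c)
    (h : ∀ (x : X) (f : StrongDual ℝ X), ‖x‖ = 1 → ‖f‖ = 1 → f x = 1 → |f (T x)| ≤ c) :
    numRadius T ≤ c := by
  apply Real.sSup_le _ hc
  rintro _ ⟨_, ⟨q, ⟨h1, h2, h3⟩, rfl⟩, rfl⟩
  exact h _ _ h1 h2 h3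

theorem numRadius_le_norm (T : X →L[ℝ] X) : numRadius T ≤ ‖T‖ := by
  apply Real.sSup_le _ (norm_nonneg _)
  rintro _ ⟨a, ha, rfl⟩
  exact numRange_abs_le T ha

theorem numRadius_smul_le (c : ℝ) (T : X →L[ℝ] X) :
    numRadius (c • T) ≤ |c| * numRadius T := by
  refine numRadius_le (mul_nonneg (abs_nonneg _) (numRadius_nonneg T)) fun x f hx hf hfx => ?_
  have : f ((c • T) x) = c * f (T x) := by simp
  rw [this, abs_mul]
  exact mul_le_mul_of_nonneg_left (abs_apply_le_numRadius T hx hf hfx) (abs_nonneg _)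

theorem numIndex_le_numRadius {T : X →L[ℝ] X} (hT : ‖T‖ = 1) : numIndex X ≤ numRadius T :=
  csInf_le ⟨0, by rintro _ ⟨S, -, rfl⟩; exact numRadius_nonneg S⟩ ⟨T, hT, rfl⟩

theorem numIndex_nonneg : 0 ≤ numIndex X := by
  apply Real.sInf_nonneg
  rintro _ ⟨S, -, rfl⟩
  exact numRadius_nonneg S

theorem le_numIndex [Nontrivial X] {c : ℝ}
    (h : ∀ T : X →L[ℝ] X, ‖T‖ = 1 → c ≤ numRadius T) : c ≤ numIndex X := by
  refine le_csInf ⟨_, ContinuousLinearMap.id ℝ X, ContinuousLinearMap.norm_id, rfl⟩ ?_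
  rintro _ ⟨T, hT, rfl⟩
  exact h T hT

theorem numIndex_mul_norm_le (T : X →L[ℝ] X) : numIndex X * ‖T‖ ≤ numRadius T := by
  rcases eq_or_ne T 0 with rfl | hT
  · simpa using numRadius_nonneg (0 : X →L[ℝ] X)
  have hpos : 0 < ‖T‖ := norm_pos_iff.2 hT
  have h1 : ‖(‖T‖⁻¹ • T)‖ = 1 := by
    rw [norm_smul, norm_inv, norm_norm, inv_mul_cancel₀ hpos.ne']
  have h2 := (numIndex_le_numRadius h1).trans (numRadius_smul_le _ _)
  rw [abs_of_pos (inv_pos.2 hpos), inv_mul_eq_div, le_div_iff₀ hpos] at h2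
  exact h2

theorem secondNumIndex_nonneg : 0 ≤ secondNumIndex X := by
  apply Real.sInf_nonneg
  rintro _ ⟨S, -, rfl⟩
  exact numRadius_nonneg S

theorem secondNumIndex_le_numRadius {T : X →L[ℝ] X}
    (hT : ‖(Submodule.Quotient.mk T : (X →L[ℝ] X) ⧸ lieAlg X)‖ = 1) :
    secondNumIndex X ≤ numRadius T :=
  csInf_le ⟨0, by rintro _ ⟨S, -, rfl⟩; exact numRadius_nonneg S⟩ ⟨T, hT, rfl⟩

theorem norm_mk_lieAlg_eq_one {T : X →L[ℝ] X} (hle : ‖T‖ ≤ 1)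
    (hT : ∀ S ∈ lieAlg X, 1 ≤ ‖T - S‖) :
    ‖(Submodule.Quotient.mk T : (X →L[ℝ] X) ⧸ lieAlg X)‖ = 1 := by
  refine le_antisymm ((Submodule.Quotient.norm_mk_le _ T).trans hle)
    (le_of_forall_pos_lt_add fun ε hε => ?_)
  obtain ⟨R, hR, hlt⟩ := Submodule.Quotient.norm_mk_lt
    (Submodule.Quotient.mk T : (X →L[ℝ] X) ⧸ lieAlg X) hε
  refine lt_of_le_of_lt ?_ hlt
  have := hT (T - R) ((Submodule.Quotient.eq _).1 hR.symm)
  rwa [sub_sub_cancel] at this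

theorem norm_mk_lieAlg_le (T : X →L[ℝ] X) {S : X →L[ℝ] X} (hS : S ∈ lieAlg X) :
    ‖(Submodule.Quotient.mk T : (X →L[ℝ] X) ⧸ lieAlg X)‖ ≤ ‖T - S‖ := by
  have h : (Submodule.Quotient.mk T : (X →L[ℝ] X) ⧸ lieAlg X) = Submodule.Quotient.mk (T - S) := by
    rw [Submodule.Quotient.eq]
    simpa using hS
  rw [h]
  exact Submodule.Quotient.norm_mk_le _ _

/-- A pair $(y,g)\in\Pi(Y)$ lifts to $(Ly, g\circ P)\in\Pi(X)$. The section `L` need not be the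
canonical embedding; `numIndex_mul_norm_fst_le` uses a slanted one. -/
theorem numRadius_comp_comp_le {L : Y →L[ℝ] X} {P : X →L[ℝ] Y} (hPL : ∀ y, P (L y) = y)
    (hP : ∀ x, ‖P x‖ ≤ ‖x‖) (hL : ∀ y, ‖L y‖ ≤ ‖y‖) (T : X →L[ℝ] X) :
    numRadius (P ∘L T ∘L L) ≤ numRadius T := by
  refine numRadius_le (numRadius_nonneg T) fun y g hy hg hgy => ?_
  refine abs_apply_le_numRadius T (x := L y) (f := g ∘L P) ?_ ?_ ?_
  · refine le_antisymm ((hL y).trans_eq hy) ?_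
    rw [← hy]
    nth_rw 1 [← hPL y]
    exact hP _
  · apply le_antisymm
    · refine ContinuousLinearMap.opNorm_le_bound _ zero_le_one fun x => ?_
      rw [← hg]
      exact (g.le_opNorm _).trans (mul_le_mul_of_nonneg_left (hP x) (norm_nonneg _))
    · rw [← hg]
      refine ContinuousLinearMap.opNorm_le_bound _ (norm_nonneg _) fun z => ?_
      have h := (g ∘L P).le_opNorm (L z)
      rw [ContinuousLinearMap.comp_apply, hPL] at h
      exact h.trans (mul_le_mul_of_nonneg_left (hL z) (norm_nonneg _))
  · simp [hPL, hgy]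

/-- `Y` is an M-summand of `X`, with embedding `I` and projection `P`. -/
structure IsMSummand (I : Y →L[ℝ] X) (P : X →L[ℝ] Y) : Prop where
  proj_incl : ∀ y, P (I y) = y
  norm_eq : ∀ x, ‖x‖ = max ‖P x‖ ‖x - I (P x)‖

namespace IsMSummand

variable {I : Y →L[ℝ] X} {P : X →L[ℝ] Y}

theorem norm_proj_le (h : IsMSummand I P) (x : X) : ‖P x‖ ≤ ‖x‖ := by
  rw [h.norm_eq x]; exact le_max_left _ _

theorem norm_incl (h : IsMSummand I P) (y : Y) : ‖I y‖ = ‖y‖ := by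
  rw [h.norm_eq, h.proj_incl]; simp

theorem norm_comp_comp_le (h : IsMSummand I P) (T : X →L[ℝ] X) : ‖P ∘L T ∘L I‖ ≤ ‖T‖ :=
  ContinuousLinearMap.opNorm_le_bound _ (norm_nonneg _) fun y =>
    (h.norm_proj_le _).trans ((T.le_opNorm _).trans_eq (congrArg _ (h.norm_incl y)))

theorem norm_extend (h : IsMSummand I P) (T : Y →L[ℝ] Y) : ‖I ∘L T ∘L P‖ = ‖T‖ := by
  apply le_antisymm
  · refine ContinuousLinearMap.opNorm_le_bound _ (norm_nonneg _) fun x => ?_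
    rw [ContinuousLinearMap.comp_apply, h.norm_incl]
    exact (T.le_opNorm _).trans (mul_le_mul_of_nonneg_left (h.norm_proj_le x) (norm_nonneg _))
  · have := h.norm_comp_comp_le (I ∘L T ∘L P)
    have e : P ∘L (I ∘L T ∘L P) ∘L I = T := by ext y; simp [h.proj_incl]
    rwa [e] at this

theorem numRadius_compress_le (h : IsMSummand I P) (T : X →L[ℝ] X) :
    numRadius (P ∘L T ∘L I) ≤ numRadius T :=
  numRadius_comp_comp_le h.proj_incl h.norm_proj_le (fun y => (h.norm_incl y).le) T

/-- If $f$ attains its norm at $x$, then $g=f\circ I$ attains its norm at $Px$, because the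
$Y$-component of $x$ can be varied freely in the unit ball. Unless $g=0$, normalizing $g$ gives a
pair in $\Pi(Y)$. -/
theorem numRadius_extend_le (h : IsMSummand I P) (T : Y →L[ℝ] Y) :
    numRadius (I ∘L T ∘L P) ≤ numRadius T := by
  refine numRadius_le (numRadius_nonneg T) fun x f hx hf hfx => ?_
  set g : StrongDual ℝ Y := f ∘L I with hg
  have hgf : f ((I ∘L T ∘L P) x) = g (T (P x)) := rfl
  have hPx : ‖P x‖ ≤ 1 := hx ▸ h.norm_proj_le x
  have key : ∀ y, ‖y‖ ≤ 1 → g y ≤ g (P x) := by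
    intro y hy
    have h1 : ‖I y + (x - I (P x))‖ ≤ 1 := by
      rw [h.norm_eq]
      have e : P (I y + (x - I (P x))) = y := by simp [h.proj_incl]
      rw [e]
      refine max_le hy ?_
      rw [add_sub_cancel_left, ← hx, h.norm_eq x]
      exact le_max_right _ _
    have h2 : f (I y + (x - I (P x))) ≤ 1 :=
      (le_abs_self _).trans ((f.le_opNorm _).trans (by rw [hf, one_mul]; exact h1))
    simp only [map_add, map_sub, hfx] at h2
    change f (I y) ≤ f (I (P x))
    linarith
  have hnorm : ‖g‖ ≤ g (P x) := by
    have h0 : 0 ≤ g (P x) := by simpa using key 0 (by simp)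
    refine ContinuousLinearMap.opNorm_le_of_unit_norm h0 fun y hy => ?_
    rw [Real.norm_eq_abs]
    refine abs_le.2 ⟨?_, key y hy.le⟩
    have := key (-y) (by rw [norm_neg, hy])
    rw [map_neg] at this
    linarith
  have hle : g (P x) ≤ ‖g‖ * ‖P x‖ := (le_abs_self _).trans (g.le_opNorm _)
  have hg1 : ‖g‖ ≤ 1 := by
    refine ContinuousLinearMap.opNorm_le_bound _ zero_le_one fun y => ?_
    rw [← hf, ← h.norm_incl y]
    exact f.le_opNorm _
  rw [hgf]
  rcases (norm_nonneg g).eq_or_lt with h0 | h0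
  · have : g = 0 := norm_eq_zero.1 h0.symm
    rw [this]
    simpa using numRadius_nonneg T
  · have hP1 : ‖P x‖ = 1 := le_antisymm hPx (by
      have := hnorm.trans hle
      exact le_of_mul_le_mul_left (by linarith) h0)
    have hgP : g (P x) = ‖g‖ := le_antisymm (by rw [hP1, mul_one] at hle; exact hle) hnorm
    have := abs_apply_le_numRadius T (x := P x) (f := ‖g‖⁻¹ • g) hP1
      (by rw [norm_smul, norm_inv, norm_norm, inv_mul_cancel₀ h0.ne'])
      (by simp [hgP, h0.ne'])
    have e : (‖g‖⁻¹ • g) (T (P x)) = ‖g‖⁻¹ * g (T (P x)) := rfl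
    rw [e, abs_mul, abs_of_pos (inv_pos.2 h0), inv_mul_eq_div, div_le_iff₀ h0] at this
    exact this.trans (mul_le_of_le_one_right (numRadius_nonneg T) hg1)

theorem numIndex_le [Nontrivial Y] (h : IsMSummand I P) : numIndex X ≤ numIndex Y :=
  le_numIndex fun T hT =>
    (numIndex_le_numRadius ((h.norm_extend T).trans hT)).trans (h.numRadius_extend_le T)

/-- The compression to $Y$ of any $S\in\mathcal Z(X)$ has numerical radius 0, hence vanishes as
$n(Y)>0$; subtracting $S$ cannot lower the norm. -/
theorem norm_mk_extend_eq_one (h : IsMSummand I P) (hY : 0 < numIndex Y) {T : Y →L[ℝ] Y}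
    (hT : ‖T‖ = 1) :
    ‖(Submodule.Quotient.mk (I ∘L T ∘L P) : (X →L[ℝ] X) ⧸ lieAlg X)‖ = 1 := by
  refine norm_mk_lieAlg_eq_one ((h.norm_extend T).trans hT).le fun S hS => ?_
  have hS0 : numRadius S = 0 := hS
  have hPSI : P ∘L S ∘L I = 0 := by
    have h1 := (numIndex_mul_norm_le (P ∘L S ∘L I)).trans ((h.numRadius_compress_le S).trans_eq hS0)
    exact norm_le_zero_iff.1 (nonpos_of_mul_nonpos_right h1 hY)
  have e : P ∘L (I ∘L T ∘L P - S) ∘L I = T := by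
    have : P ∘L (I ∘L T ∘L P - S) ∘L I = T - P ∘L S ∘L I := by ext y; simp [h.proj_incl]
    rw [this, hPSI, sub_zero]
  have := h.norm_comp_comp_le (I ∘L T ∘L P - S)
  rwa [e, hT] at this

theorem secondNumIndex_le [Nontrivial Y] (h : IsMSummand I P) (hY : 0 < numIndex Y) :
    secondNumIndex X ≤ numIndex Y :=
  le_numIndex fun _ hT =>
    (secondNumIndex_le_numRadius (h.norm_mk_extend_eq_one hY hT)).trans (h.numRadius_extend_le _)

end IsMSummand

theorem numIndex_eq_zero_of_numRadius_eq_zero {T : X →L[ℝ] X} (hT : T ≠ 0)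
    (h : numRadius T = 0) : numIndex X = 0 :=
  le_antisymm (nonpos_of_mul_nonpos_left ((numIndex_mul_norm_le T).trans_eq h)
    (norm_pos_iff.2 hT)) numIndex_nonneg

/-- Lumer's estimate. -/
theorem le_norm_sub_smul (T : X →L[ℝ] X) {a : ℝ} (ha : 0 ≤ a) (x : X) :
    (1 - a * numRadius T) * ‖x‖ ≤ ‖x - a • T x‖ := by
  rcases eq_or_ne x 0 with rfl | hx
  · simp
  have hpos : 0 < ‖x‖ := norm_pos_iff.2 hx
  obtain ⟨f, hf, hfx⟩ := exists_dual_vector ℝ x hpos.ne'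
  have hfx' : f x = ‖x‖ := by simpa using hfx
  have h1 := abs_apply_le_numRadius T (x := ‖x‖⁻¹ • x) (f := f)
    (by rw [norm_smul, norm_inv, norm_norm, inv_mul_cancel₀ hpos.ne']) hf
    (by simp [hfx', hpos.ne'])
  rw [map_smul, map_smul, smul_eq_mul, abs_mul, abs_of_pos (inv_pos.2 hpos), inv_mul_eq_div,
    div_le_iff₀ hpos] at h1
  have h2 : f (x - a • T x) ≤ ‖x - a • T x‖ :=
    (le_abs_self _).trans ((f.le_opNorm _).trans_eq (by rw [hf, one_mul]))
  rw [map_sub, map_smul, smul_eq_mul, hfx'] at h2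
  have h3 := mul_le_mul_of_nonneg_left ((le_abs_self _).trans h1) ha
  linarith

/-- Lumer's estimate at $(1+aT)x$, with $(1-aT)(1+aT)=1-a^2T^2$: the error is of second order in
$a$. -/
theorem norm_id_add_smul_le {T : X →L[ℝ] X} (hT : ‖T‖ = 1) {a : ℝ} (ha : 0 ≤ a) (ha1 : a < 1) :
    ‖ContinuousLinearMap.id ℝ X + a • T‖ ≤ (1 + a ^ 2) / (1 - a * numRadius T) := by
  have hv : numRadius T ≤ 1 := hT ▸ numRadius_le_norm T
  have hd : 0 < 1 - a * numRadius T := by nlinarith [numRadius_nonneg T]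
  refine ContinuousLinearMap.opNorm_le_bound _ (by positivity) fun x => ?_
  rw [div_mul_eq_mul_div, le_div_iff₀ hd, mul_comm]
  refine (le_norm_sub_smul T ha _).trans ?_
  have e : (ContinuousLinearMap.id ℝ X + a • T) x - a • T ((ContinuousLinearMap.id ℝ X + a • T) x)
      = x - a ^ 2 • T (T x) := by
    simp only [add_apply, ContinuousLinearMap.id_apply,
      smul_apply, map_add, map_smul]
    module
  rw [e]
  have h1 : ‖T x‖ ≤ ‖x‖ := by simpa [hT] using T.le_opNorm x
  have h2 : ‖T (T x)‖ ≤ ‖x‖ := le_trans (by simpa [hT] using T.le_opNorm (T x)) h1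
  calc ‖x - a ^ 2 • T (T x)‖ ≤ ‖x‖ + ‖a ^ 2 • T (T x)‖ := norm_sub_le _ _
    _ = ‖x‖ + a ^ 2 * ‖T (T x)‖ := by rw [norm_smul, Real.norm_of_nonneg (by positivity)]
    _ ≤ ‖x‖ + a ^ 2 * ‖x‖ := by gcongr
    _ = (1 + a ^ 2) * ‖x‖ := by ring

theorem numRadius_le_of_norm_id_add_smul_le {T : X →L[ℝ] X} {a c : ℝ} (ha : 0 < a) (hc : 0 ≤ c)
    (h1 : ‖ContinuousLinearMap.id ℝ X + a • T‖ ≤ 1 + a * c)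
    (h2 : ‖ContinuousLinearMap.id ℝ X - a • T‖ ≤ 1 + a * c) : numRadius T ≤ c := by
  refine numRadius_le hc fun x f hx hf hfx => ?_
  have key : ∀ R : X →L[ℝ] X, f (R x) ≤ ‖R‖ := fun R => by
    refine (le_abs_self _).trans ((f.le_opNorm _).trans ?_)
    rw [hf, one_mul]
    simpa [hx] using R.le_opNorm x
  have k1 := (key _).trans h1
  have k2 := (key _).trans h2
  simp only [add_apply, sub_apply,
    ContinuousLinearMap.id_apply, smul_apply, map_add, map_sub, map_smul, hfx,
    smul_eq_mul] at k1 k2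
  refine abs_le.2 ⟨?_, ?_⟩ <;> nlinarith

/-- The numerical index is continuous with respect to the Banach–Mazur distance. -/
theorem numIndex_le_add_of_equiv [Nontrivial X] (e : X ≃L[ℝ] Y) {a : ℝ} (ha : 0 < a)
    (ha2 : a ≤ 1 / 2)
    (he : ‖(e : X →L[ℝ] Y)‖ * ‖(e.symm : Y →L[ℝ] X)‖ ≤ 1 + a ^ 2) :
    numIndex Y ≤ numIndex X + 15 * a := by
  suffices h : numIndex Y - 15 * a ≤ numIndex X by linarith
  refine le_numIndex fun T hT => ?_
  set c := numRadius T with hc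
  have hc0 : 0 ≤ c := numRadius_nonneg T
  have hc1 : c ≤ 1 := hT ▸ numRadius_le_norm T
  have hconj : ∀ R : X →L[ℝ] X, ‖(e : X →L[ℝ] Y) ∘L R ∘L (e.symm : Y →L[ℝ] X)‖
      ≤ (1 + a ^ 2) * ‖R‖ := fun R => by
    calc _ ≤ ‖(e : X →L[ℝ] Y)‖ * (‖R‖ * ‖(e.symm : Y →L[ℝ] X)‖) :=
          (ContinuousLinearMap.opNorm_comp_le _ _).trans
            (mul_le_mul_of_nonneg_left (ContinuousLinearMap.opNorm_comp_le _ _) (norm_nonneg _))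
      _ = (‖(e : X →L[ℝ] Y)‖ * ‖(e.symm : Y →L[ℝ] X)‖) * ‖R‖ := by ring
      _ ≤ _ := by gcongr
  -- Conjugation costs a factor $1+a^2$, of the same order as the error in `norm_id_add_smul_le`;
  -- dividing by $a$ later leaves only $O(a)$.
  have hreal : (1 + a ^ 2) * ((1 + a ^ 2) / (1 - a * c)) ≤ 1 + a * (c + 7 * a) := by
    have hd : 0 < 1 - a * c := by nlinarith
    rw [← mul_div_assoc, div_le_iff₀ hd]
    have h1 : c ^ 2 ≤ 1 := by nlinarith
    have h2 : a * c ≤ 1 / 2 := by nlinarith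
    have h3 : a ^ 2 ≤ 1 / 4 := by nlinarith
    have h4 : 0 ≤ a ^ 2 * (1 - c ^ 2 + 7 * (1 / 2 - a * c) + (1 / 4 - a ^ 2)) := by
      apply mul_nonneg (sq_nonneg a); linarith
    nlinarith [sq_nonneg a]
  set T' : Y →L[ℝ] Y := (e : X →L[ℝ] Y) ∘L T ∘L (e.symm : Y →L[ℝ] X) with hT'
  have hnorm : 1 ≤ (1 + a ^ 2) * ‖T'‖ := by
    have e1 : T = (e.symm : Y →L[ℝ] X) ∘L T' ∘L (e : X →L[ℝ] Y) := by ext x; simp [hT']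
    calc 1 = ‖T‖ := hT.symm
      _ ≤ ‖(e.symm : Y →L[ℝ] X)‖ * (‖T'‖ * ‖(e : X →L[ℝ] Y)‖) := by
          nth_rw 1 [e1]
          exact (ContinuousLinearMap.opNorm_comp_le _ _).trans
            (mul_le_mul_of_nonneg_left (ContinuousLinearMap.opNorm_comp_le _ _) (norm_nonneg _))
      _ = (‖(e : X →L[ℝ] Y)‖ * ‖(e.symm : Y →L[ℝ] X)‖) * ‖T'‖ := by ring
      _ ≤ _ := by gcongr
  have hv : numRadius T' ≤ c + 7 * a := by
    apply numRadius_le_of_norm_id_add_smul_le ha (by positivity)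
    · have e1 : ContinuousLinearMap.id ℝ Y + a • T' = (e : X →L[ℝ] Y) ∘L
          (ContinuousLinearMap.id ℝ X + a • T) ∘L (e.symm : Y →L[ℝ] X) := by ext y; simp [hT']
      rw [e1]
      refine (hconj _).trans (le_trans ?_ hreal)
      gcongr
      exact norm_id_add_smul_le hT ha.le (by linarith)
    · have hneg : numRadius (-T) ≤ c := by simpa using numRadius_smul_le (-1) T
      have e1 : ContinuousLinearMap.id ℝ Y - a • T' = (e : X →L[ℝ] Y) ∘L
          (ContinuousLinearMap.id ℝ X + a • (-T)) ∘L (e.symm : Y →L[ℝ] X) := by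
        ext y; simp [hT', sub_eq_add_neg]
      rw [e1]
      refine (hconj _).trans (le_trans ?_ hreal)
      gcongr
      refine (norm_id_add_smul_le (by rwa [norm_neg]) ha.le (by linarith)).trans ?_
      have hd : 0 < 1 - a * c := by nlinarith
      gcongr
  have h5 := (numIndex_mul_norm_le T').trans hv
  have h6 : numIndex Y ≤ (1 + a ^ 2) * (c + 7 * a) := by
    calc numIndex Y ≤ numIndex Y * ((1 + a ^ 2) * ‖T'‖) :=
          le_mul_of_one_le_right numIndex_nonneg hnorm
      _ = (1 + a ^ 2) * (numIndex Y * ‖T'‖) := by ring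
      _ ≤ _ := by gcongr
  nlinarith [mul_nonneg ha.le ha.le]

theorem numIndex_le_of_linearIsometryEquiv [Nontrivial X] (e : X ≃ₗᵢ[ℝ] Y) :
    numIndex Y ≤ numIndex X := by
  refine le_of_forall_pos_le_add fun ε hε => ?_
  have ha : 0 < min (1 / 2) (ε / 15) := by positivity
  refine (numIndex_le_add_of_equiv e.toContinuousLinearEquiv ha (min_le_left _ _) ?_).trans ?_
  · have h1 : ‖(e.toContinuousLinearEquiv : X →L[ℝ] Y)‖ ≤ 1 :=
      e.toLinearIsometry.norm_toContinuousLinearMap_le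
    have h2 : ‖(e.toContinuousLinearEquiv.symm : Y →L[ℝ] X)‖ ≤ 1 :=
      e.symm.toLinearIsometry.norm_toContinuousLinearMap_le
    nlinarith [mul_le_one₀ h1 (norm_nonneg _) h2, sq_nonneg (min (1 / 2) (ε / 15))]
  · have := min_le_right (1 / 2) (ε / 15)
    linarith

end Basic

/-! ### The sum $Y\oplus_\infty H$ with $H$ an inner product space. -/

section Prod

variable {Y H : Type*} [NormedAddCommGroup Y] [NormedSpace ℝ Y]

section Normed

variable [NormedAddCommGroup H] [NormedSpace ℝ H]

variable (Y H) in
/-- The embedding of the first summand into an `ℓ_∞`-sum. -/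
noncomputable def supInl : Y →L[ℝ] WithLp ∞ (Y × H) :=
  ((WithLp.prodContinuousLinearEquiv ∞ ℝ Y H).symm : Y × H →L[ℝ] WithLp ∞ (Y × H)) ∘L
    ContinuousLinearMap.inl ℝ Y H

variable (Y H) in
/-- The embedding of the second summand into an `ℓ_∞`-sum. -/
noncomputable def supInr : H →L[ℝ] WithLp ∞ (Y × H) :=
  ((WithLp.prodContinuousLinearEquiv ∞ ℝ Y H).symm : Y × H →L[ℝ] WithLp ∞ (Y × H)) ∘L
    ContinuousLinearMap.inr ℝ Y H

variable (Y H) in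
/-- The first projection of an `ℓ_∞`-sum. -/
noncomputable def supFst : WithLp ∞ (Y × H) →L[ℝ] Y :=
  ContinuousLinearMap.fst ℝ Y H ∘L
    (WithLp.prodContinuousLinearEquiv ∞ ℝ Y H : WithLp ∞ (Y × H) →L[ℝ] Y × H)

variable (Y H) in
/-- The second projection of an `ℓ_∞`-sum. -/
noncomputable def supSnd : WithLp ∞ (Y × H) →L[ℝ] H :=
  ContinuousLinearMap.snd ℝ Y H ∘L
    (WithLp.prodContinuousLinearEquiv ∞ ℝ Y H : WithLp ∞ (Y × H) →L[ℝ] Y × H)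

@[simp] theorem supFst_apply (x : WithLp ∞ (Y × H)) : supFst Y H x = x.fst := rfl
@[simp] theorem supSnd_apply (x : WithLp ∞ (Y × H)) : supSnd Y H x = x.snd := rfl
@[simp] theorem supInl_fst (y : Y) : (supInl Y H y).fst = y := rfl
@[simp] theorem supInl_snd (y : Y) : (supInl Y H y).snd = 0 := rfl
@[simp] theorem supInr_fst (h : H) : (supInr Y H h).fst = 0 := rfl
@[simp] theorem supInr_snd (h : H) : (supInr Y H h).snd = h := rfl

theorem supInl_add_supInr (x : WithLp ∞ (Y × H)) :
    supInl Y H x.fst + supInr Y H x.snd = x := by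
  refine (WithLp.prodContinuousLinearEquiv ∞ ℝ Y H).injective (Prod.ext ?_ ?_)
  · exact add_zero _
  · exact zero_add _

theorem isMSummand_fst : IsMSummand (supInl Y H) (supFst Y H) where
  proj_incl _ := rfl
  norm_eq x := by simp [WithLp.prod_norm_eq_sup]

theorem isMSummand_snd : IsMSummand (supInr Y H) (supSnd Y H) where
  proj_incl _ := rfl
  norm_eq x := by simp [WithLp.prod_norm_eq_sup, max_comm]

/-- Compressing $T$ along a section $z\mapsto(z,\varphi(z)h)$, with $h$ the second coordinate of $x$
and $\varphi$ norming $y$, yields an operator on $Y$ whose value at $y$ also sees the block $H\to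
Y$. -/
theorem numIndex_mul_norm_fst_le [Nontrivial Y] (T : WithLp ∞ (Y × H) →L[ℝ] WithLp ∞ (Y × H))
    {x : WithLp ∞ (Y × H)} (hx : ‖x‖ ≤ 1) : numIndex Y * ‖(T x).fst‖ ≤ numRadius T := by
  have hx1 : ‖x.fst‖ ≤ 1 := (le_max_left _ _).trans hx
  have hx2 : ‖x.snd‖ ≤ 1 := (le_max_right _ _).trans hx
  set B := supFst Y H (T (supInr Y H x.snd)) with hB
  set A := supFst Y H ∘L T ∘L supInl Y H with hA
  have key : ∀ y : Y, ‖y‖ = 1 → numIndex Y * ‖A y + B‖ ≤ numRadius T := by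
    intro y hy
    obtain ⟨φ, hφ, hφy⟩ := exists_dual_vector' ℝ y
    have hφy1 : φ y = 1 := by simpa [hy] using hφy
    set L : Y →L[ℝ] WithLp ∞ (Y × H) := supInl Y H + φ.smulRight (supInr Y H x.snd) with hL
    have hR := (numIndex_mul_norm_le (supFst Y H ∘L T ∘L L)).trans
      (numRadius_comp_comp_le (L := L) (P := supFst Y H) (fun z => by simp [hL])
        isMSummand_fst.norm_proj_le (fun z => ?_) T)
    · have hRy : (supFst Y H ∘L T ∘L L) y = A y + B := by simp [hL, hA, hB, hφy1]
      refine le_trans (mul_le_mul_of_nonneg_left ?_ numIndex_nonneg) hR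
      rw [← hRy]
      simpa [hy] using (supFst Y H ∘L T ∘L L).le_opNorm y
    · have h1 : |φ z| ≤ ‖z‖ := by simpa [hφ] using φ.le_opNorm z
      rw [WithLp.prod_norm_eq_sup]
      refine max_le (by simp [hL]) ?_
      have : (L z).snd = φ z • x.snd := by simp [hL]
      rw [this, norm_smul, Real.norm_eq_abs]
      exact (mul_le_of_le_one_right (abs_nonneg _) hx2).trans h1
  obtain ⟨y, hy, hxy⟩ : ∃ y : Y, ‖y‖ = 1 ∧ x.fst = ‖x.fst‖ • y := by
    rcases eq_or_ne x.fst 0 with h0 | h0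
    · obtain ⟨y, hy⟩ := exists_norm_eq Y zero_le_one
      exact ⟨y, hy, by simp [h0]⟩
    · have hpos : ‖x.fst‖ ≠ 0 := norm_ne_zero_iff.2 h0
      exact ⟨‖x.fst‖⁻¹ • x.fst, by rw [norm_smul, norm_inv, norm_norm, inv_mul_cancel₀ hpos],
        by rw [smul_smul, mul_inv_cancel₀ hpos, one_smul]⟩
  set t := ‖x.fst‖ with ht
  have ht0 : 0 ≤ t := norm_nonneg _
  -- The bound is known for unit first coordinates only; $x.\mathrm{fst}=ty$ is a convex combination
  -- of $y$ and $-y$.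
  have hTx : (T x).fst = ((1 + t) / 2) • (A y + B) + ((1 - t) / 2) • (A (-y) + B) := by
    have h1 : (T x).fst = A x.fst + B := by
      nth_rw 1 [← supInl_add_supInr x]
      rw [map_add]
      rfl
    rw [h1, hxy, map_smul, map_neg]
    module
  have k1 := key y hy
  have k2 := key (-y) (by rw [norm_neg, hy])
  have h2 : ‖(T x).fst‖ ≤ (1 + t) / 2 * ‖A y + B‖ + (1 - t) / 2 * ‖A (-y) + B‖ := by
    rw [hTx]
    refine (norm_add_le _ _).trans_eq ?_
    rw [norm_smul, norm_smul, Real.norm_of_nonneg (by linarith), Real.norm_of_nonneg (by linarith)]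
  calc numIndex Y * ‖(T x).fst‖
      ≤ numIndex Y * ((1 + t) / 2 * ‖A y + B‖ + (1 - t) / 2 * ‖A (-y) + B‖) :=
        mul_le_mul_of_nonneg_left h2 numIndex_nonneg
    _ = (1 + t) / 2 * (numIndex Y * ‖A y + B‖) + (1 - t) / 2 * (numIndex Y * ‖A (-y) + B‖) := by
        ring
    _ ≤ (1 + t) / 2 * numRadius T + (1 - t) / 2 * numRadius T := by gcongr
    _ = numRadius T := by ring

end Normed

section Inner

open scoped InnerProductSpace

variable [NormedAddCommGroup H] [InnerProductSpace ℝ H]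

/-- The only norm-one functional with value 1 at a unit vector $x$ is $\langle x,\cdot\rangle$,
proved by perturbing $x$ orthogonally, so that completeness is not needed. -/
theorem numRadius_eq_zero_of_inner_eq_zero {S : H →L[ℝ] H} (h : ∀ u, ⟪u, S u⟫_ℝ = 0) :
    numRadius S = 0 := by
  refine le_antisymm (numRadius_le le_rfl fun x f hx hf hfx => ?_) (numRadius_nonneg S)
  have hfz : ∀ z, f z = ⟪x, z⟫_ℝ := by
    intro z
    set w := z - ⟪x, z⟫_ℝ • x with hw
    have hxw : ⟪x, w⟫_ℝ = 0 := by
      rw [hw, inner_sub_right, real_inner_smul_right, real_inner_self_eq_norm_sq, hx]; ring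
    have hfw : f w = 0 := by
      have key : ∀ t : ℝ, 1 + 2 * t * f w + t ^ 2 * f w ^ 2 ≤ 1 + t ^ 2 * ‖w‖ ^ 2 := by
        intro t
        have h1 : |f (x + t • w)| ≤ ‖x + t • w‖ := by simpa [hf] using f.le_opNorm (x + t • w)
        have h2 : ‖x + t • w‖ ^ 2 = 1 + t ^ 2 * ‖w‖ ^ 2 := by
          rw [norm_add_sq_real, real_inner_smul_right, hxw, hx, norm_smul, mul_pow,
            Real.norm_eq_abs, sq_abs]
          ring
        have h3 : f (x + t • w) = 1 + t * f w := by simp [hfx]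
        rw [h3] at h1
        have h4 := sq_le_sq' (by linarith [abs_nonneg (1 + t * f w), norm_nonneg (x + t • w)]) h1
        rw [sq_abs, h2] at h4
        linarith
      by_contra hne
      have hpos : 0 < f w ^ 2 := by positivity
      -- For this $t$ the linear term $2t f(w)=2t^2(1+\|w\|^2)$ exceeds $t^2\|w\|^2$.
      have k := key (f w / (1 + ‖w‖ ^ 2))
      have hd : 0 < 1 + ‖w‖ ^ 2 := by positivity
      set r := f w / (1 + ‖w‖ ^ 2) with hr
      have hrw : f w = r * (1 + ‖w‖ ^ 2) := by rw [hr]; field_simp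
      have hr0 : r ≠ 0 := by
        rintro h0
        rw [h0, zero_mul] at hrw
        exact hne hrw
      have hr2 : 0 < r ^ 2 := by positivity
      have h5 : 2 * r * f w = 2 * r ^ 2 * (1 + ‖w‖ ^ 2) := by rw [hrw]; ring
      have h6 : 0 ≤ r ^ 2 * f w ^ 2 := by positivity
      nlinarith [mul_nonneg hr2.le (sq_nonneg ‖w‖)]
    have hz : z = w + ⟪x, z⟫_ℝ • x := by rw [hw]; abel
    calc f z = f (w + ⟪x, z⟫_ℝ • x) := congrArg f hz
      _ = ⟪x, z⟫_ℝ := by rw [map_add, map_smul, hfw, hfx]; simp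
  rw [hfz, h, abs_zero]

/-- The functional $\langle u,\cdot\rangle$ on the second coordinate ignores the first, so any $y$
in the unit ball gives a pair in $\Pi$. -/
theorem abs_inner_snd_le (T : WithLp ∞ (Y × H) →L[ℝ] WithLp ∞ (Y × H)) {y : Y} {u : H}
    (hy : ‖y‖ ≤ 1) (hu : ‖u‖ = 1) :
    |⟪u, (T (supInl Y H y)).snd⟫_ℝ + ⟪u, (T (supInr Y H u)).snd⟫_ℝ| ≤ numRadius T := by
  have hf : ‖(innerSL ℝ u ∘L supSnd Y H : StrongDual ℝ (WithLp ∞ (Y × H)))‖ = 1 := by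
    apply le_antisymm
    · refine ContinuousLinearMap.opNorm_le_bound _ zero_le_one fun x => ?_
      refine (norm_inner_le_norm (𝕜 := ℝ) u x.snd).trans ?_
      rw [hu]
      exact mul_le_mul_of_nonneg_left (isMSummand_snd.norm_proj_le x) zero_le_one
    · have := (innerSL ℝ u ∘L supSnd Y H).le_opNorm (supInr Y H u)
      rw [isMSummand_snd.norm_incl, hu] at this
      simpa [hu] using this
  have := abs_apply_le_numRadius T (x := supInl Y H y + supInr Y H u)
    (f := innerSL ℝ u ∘L supSnd Y H) (by simp [WithLp.prod_norm_eq_sup, hu, hy]) hf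
    (by simp [hu])
  simpa [inner_add_right] using this

/-- Replacing $y$ by $-y$ in `abs_inner_snd_le` and subtracting cancels the $H\to H$ term. -/
theorem norm_snd_supInl_le (T : WithLp ∞ (Y × H) →L[ℝ] WithLp ∞ (Y × H)) {y : Y}
    (hy : ‖y‖ ≤ 1) : ‖(T (supInl Y H y)).snd‖ ≤ numRadius T := by
  set w := (T (supInl Y H y)).snd with hw
  rcases eq_or_ne w 0 with h0 | h0
  · rw [h0, norm_zero]; exact numRadius_nonneg T
  have hpos : 0 < ‖w‖ := norm_pos_iff.2 h0
  set u := ‖w‖⁻¹ • w with hu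
  have hu1 : ‖u‖ = 1 := by rw [hu, norm_smul, norm_inv, norm_norm, inv_mul_cancel₀ hpos.ne']
  have h1 := abs_inner_snd_le T hy hu1
  have h2 := abs_inner_snd_le T (y := -y) (by rwa [norm_neg]) hu1
  have huw : ⟪u, w⟫_ℝ = ‖w‖ := by
    rw [hu, real_inner_smul_left, real_inner_self_eq_norm_sq]; field_simp
  simp only [map_neg, WithLp.neg_snd, inner_neg_right] at h2
  rw [← hw, huw] at h1 h2
  have := (abs_le.1 h1).2
  have := (abs_le.1 h2).1
  linarith

/-- Polarization: the symmetric part has the same quadratic form as $D$, and for self-adjoint maps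
this form controls the norm. -/
theorem norm_self_add_adjoint_le [CompleteSpace H] {D : H →L[ℝ] H} {v : ℝ}
    (hv : ∀ u, ‖u‖ = 1 → |⟪u, D u⟫_ℝ| ≤ v) (u : H) (hu : ‖u‖ ≤ 1) (hv0 : 0 ≤ v) :
    ‖(2⁻¹ : ℝ) • (D + D.adjoint) u‖ ≤ v := by
  have hv' : ∀ u, |⟪u, D u⟫_ℝ| ≤ v * ‖u‖ ^ 2 := by
    intro u
    rcases eq_or_ne u 0 with rfl | h0
    · simp
    have hpos : 0 < ‖u‖ := norm_pos_iff.2 h0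
    have h1 := hv (‖u‖⁻¹ • u) (by rw [norm_smul, norm_inv, norm_norm, inv_mul_cancel₀ hpos.ne'])
    rw [map_smul, real_inner_smul_left, real_inner_smul_right, ← mul_assoc, abs_mul,
      abs_of_pos (by positivity), ← mul_inv, inv_mul_eq_div, div_le_iff₀ (by positivity)] at h1
    rwa [sq]
  set z := (2⁻¹ : ℝ) • (D + D.adjoint) u with hz
  rcases eq_or_ne z 0 with h0 | h0
  · rw [h0, norm_zero]; exact hv0
  have hpos : 0 < ‖z‖ := norm_pos_iff.2 h0
  set w := ‖z‖⁻¹ • z with hw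
  have hw1 : ‖w‖ = 1 := by rw [hw, norm_smul, norm_inv, norm_norm, inv_mul_cancel₀ hpos.ne']
  have hwz : ⟪w, z⟫_ℝ = ‖z‖ := by
    rw [hw, real_inner_smul_left, real_inner_self_eq_norm_sq]; field_simp
  have hpol : 4 * ⟪w, z⟫_ℝ = ⟪u + w, D (u + w)⟫_ℝ - ⟪u - w, D (u - w)⟫_ℝ := by
    have h1 : ⟪w, z⟫_ℝ = 2⁻¹ * (⟪w, D u⟫_ℝ + ⟪u, D w⟫_ℝ) := by
      rw [hz, real_inner_smul_right, add_apply, inner_add_right,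
        ContinuousLinearMap.adjoint_inner_right, real_inner_comm u]
    rw [h1]
    simp only [map_add, map_sub, inner_add_left, inner_add_right, inner_sub_left, inner_sub_right]
    ring
  have h1 := (abs_le.1 (hv' (u + w))).2
  have h2 := (abs_le.1 (hv' (u - w))).1
  have h3 := parallelogram_law_with_norm ℝ u w
  rw [hwz] at hpol
  rw [hw1] at h3
  have h4 : ‖u‖ * ‖u‖ ≤ 1 := mul_le_one₀ hu (norm_nonneg _) hu
  nlinarith

theorem numIndex_withLp_prod_eq_zero {J : H →L[ℝ] H} (hJ : J ≠ 0) (h : ∀ u, ⟪u, J u⟫_ℝ = 0) :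
    numIndex (WithLp ∞ (Y × H)) = 0 := by
  have hM : IsMSummand (supInr Y H) (supSnd Y H) := isMSummand_snd
  refine numIndex_eq_zero_of_numRadius_eq_zero (T := supInr Y H ∘L J ∘L supSnd Y H) ?_ ?_
  · rw [← norm_ne_zero_iff, hM.norm_extend]
    exact norm_ne_zero_iff.2 hJ
  · exact le_antisymm ((hM.numRadius_extend_le J).trans_eq
      (numRadius_eq_zero_of_inner_eq_zero h)) (numRadius_nonneg _)

theorem exists_mem_lieAlg_norm_sub_le [Nontrivial Y] [CompleteSpace H]
    (hY : 0 < numIndex Y) (hY2 : numIndex Y ≤ 1 / 2)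
    (T : WithLp ∞ (Y × H) →L[ℝ] WithLp ∞ (Y × H)) :
    ∃ S ∈ lieAlg (WithLp ∞ (Y × H)), numIndex Y * ‖T - S‖ ≤ numRadius T := by
  set v := numRadius T with hv
  have hv0 : 0 ≤ v := numRadius_nonneg T
  set D : H →L[ℝ] H := supSnd Y H ∘L T ∘L supInr Y H with hD
  set K : H →L[ℝ] H := (2⁻¹ : ℝ) • (D - D.adjoint) with hK
  have hM : IsMSummand (supInr Y H) (supSnd Y H) := isMSummand_snd
  have hK0 : numRadius K = 0 := by
    refine numRadius_eq_zero_of_inner_eq_zero fun u => ?_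
    rw [hK, smul_apply, real_inner_smul_right, sub_apply, inner_sub_right,
      ContinuousLinearMap.adjoint_inner_right, real_inner_comm u, sub_self, mul_zero]
  refine ⟨supInr Y H ∘L K ∘L supSnd Y H, ?_, ?_⟩
  · exact le_antisymm ((hM.numRadius_extend_le K).trans_eq hK0) (numRadius_nonneg _)
  rw [mul_comm, ← le_div_iff₀ hY]
  -- The only use of $n(Y)\le 1/2$.
  have hvY : 2 * v ≤ v / numIndex Y := by
    rw [le_div_iff₀ hY]; nlinarith
  refine ContinuousLinearMap.opNorm_le_of_unit_norm (by positivity) fun x hx => ?_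
  have hx2 : ‖x.snd‖ ≤ 1 := (le_max_right _ _).trans hx.le
  have hx1 : ‖x.fst‖ ≤ 1 := (le_max_left _ _).trans hx.le
  rw [WithLp.prod_norm_eq_sup]
  refine max_le ?_ (le_trans ?_ hvY)
  · rw [le_div_iff₀ hY, mul_comm]
    simpa using numIndex_mul_norm_fst_le T hx.le
  · have hD1 : ∀ u, ‖u‖ = 1 → |⟪u, D u⟫_ℝ| ≤ v := fun u hu => by
      simpa [hD] using abs_inner_snd_le T (y := (0 : Y)) (by simp) hu
    have e : ((T - supInr Y H ∘L K ∘L supSnd Y H) x).snd =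
        (T (supInl Y H x.fst)).snd + (2⁻¹ : ℝ) • (D + D.adjoint) x.snd := by
      have h1 : (T x).snd = (T (supInl Y H x.fst)).snd + D x.snd := by
        nth_rw 1 [← supInl_add_supInr x]
        rw [map_add]
        rfl
      have h2 : ((T - supInr Y H ∘L K ∘L supSnd Y H) x).snd = (T x).snd - K x.snd := rfl
      rw [h2, h1, hK]
      simp only [smul_apply, sub_apply, add_apply]
      module
    rw [e]
    refine (norm_add_le _ _).trans ?_
    have := norm_snd_supInl_le T hx1
    have := norm_self_add_adjoint_le hD1 x.snd hx2 hv0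
    linarith

theorem secondNumIndex_withLp_prod [Nontrivial Y] [CompleteSpace H]
    (hY : 0 < numIndex Y) (hY2 : numIndex Y ≤ 1 / 2) :
    secondNumIndex (WithLp ∞ (Y × H)) = numIndex Y := by
  have hM : IsMSummand (supInl Y H) (supFst Y H) := isMSummand_fst
  apply le_antisymm (hM.secondNumIndex_le hY)
  -- The extended identity shows that the infimum is over a nonempty set.
  refine le_csInf ⟨_, _, hM.norm_mk_extend_eq_one hY ContinuousLinearMap.norm_id, rfl⟩ ?_
  rintro _ ⟨T, hT, rfl⟩
  obtain ⟨S, hS, hle⟩ := exists_mem_lieAlg_norm_sub_le hY hY2 T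
  refine le_trans ?_ hle
  have := hT ▸ norm_mk_lieAlg_le T hS
  exact le_mul_of_one_le_right hY.le this

end Inner

/-- The rotation by a right angle of the Euclidean plane. -/
noncomputable def planeRotation : EuclideanSpace ℝ (Fin 2) →L[ℝ] EuclideanSpace ℝ (Fin 2) :=
  LinearMap.toContinuousLinearMap
    { toFun := fun x => !₂[-x 1, x 0]
      map_add' := fun x y => by ext i; fin_cases i <;> simp [add_comm]
      map_smul' := fun c x => by ext i; fin_cases i <;> simp }

theorem planeRotation_ne_zero : planeRotation ≠ 0 := fun h => by
  have := congrArg (fun T => T (!₂[1, 0] : EuclideanSpace ℝ (Fin 2)) 1) h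
  simp [planeRotation] at this

theorem inner_planeRotation (u : EuclideanSpace ℝ (Fin 2)) : inner ℝ u (planeRotation u) = 0 := by
  simp [planeRotation, PiLp.inner_apply, Fin.sum_univ_two]
  ring

end Prod

/-! ### Planes of every numerical index in $[0,1]$. -/

section Plane

/-- The map whose pulled-back norm is `|1 - t| ‖x‖₂ + |t| ‖x‖_∞`. -/
noncomputable def planeEmbedding (t : ℝ) :
    (Fin 2 → ℝ) →ₗ[ℝ] WithLp 1 (EuclideanSpace ℝ (Fin 2) × (Fin 2 → ℝ)) where
  toFun x := WithLp.toLp 1 ((1 - t) • WithLp.toLp 2 x, t • x)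
  map_add' x y := by simp only [WithLp.toLp_add, smul_add, ← Prod.mk_add_mk]
  map_smul' c x := by
    simp only [WithLp.toLp_smul, smul_comm _ c, ← Prod.smul_mk, RingHom.id_apply]

theorem planeEmbedding_injective (t : ℝ) : Function.Injective (planeEmbedding t) := by
  intro x y h
  have h1 : (1 - t) • x = (1 - t) • y := congrArg (fun z => WithLp.ofLp z.fst) h
  have h2 : t • x = t • y := congrArg WithLp.snd h
  calc x = (1 - t) • x + t • x := by module
    _ = y := by rw [h1, h2]; module

/-- The plane with the norm `|1 - t| ‖x‖₂ + |t| ‖x‖_∞`. -/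
def InterpolatedPlane (_ : ℝ) : Type := Fin 2 → ℝ

namespace InterpolatedPlane

noncomputable instance (t : ℝ) : AddCommGroup (InterpolatedPlane t) :=
  inferInstanceAs (AddCommGroup (Fin 2 → ℝ))

noncomputable instance (t : ℝ) : Module ℝ (InterpolatedPlane t) :=
  inferInstanceAs (Module ℝ (Fin 2 → ℝ))

/-- The identification with coordinates. -/
noncomputable def coord (t : ℝ) : InterpolatedPlane t ≃ₗ[ℝ] (Fin 2 → ℝ) := LinearEquiv.refl ℝ _

noncomputable instance (t : ℝ) : NormedAddCommGroup (InterpolatedPlane t) :=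
  NormedAddCommGroup.induced _ _ (planeEmbedding t ∘ₗ (coord t).toLinearMap)
    ((planeEmbedding_injective t).comp (coord t).injective)

noncomputable instance (t : ℝ) : NormedSpace ℝ (InterpolatedPlane t) :=
  NormedSpace.induced ℝ (InterpolatedPlane t) _ (planeEmbedding t ∘ₗ (coord t).toLinearMap)

theorem norm_eq (t : ℝ) (x : InterpolatedPlane t) :
    ‖x‖ = |1 - t| * ‖WithLp.toLp 2 (coord t x)‖ + |t| * ‖coord t x‖ := by
  have h : ‖x‖ = ‖planeEmbedding t (coord t x)‖ := rfl
  rw [h, WithLp.prod_norm_eq_of_L1]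
  change ‖(1 - t) • WithLp.toLp 2 (coord t x)‖ + ‖t • coord t x‖ = _
  rw [norm_smul, norm_smul, Real.norm_eq_abs, Real.norm_eq_abs]

theorem finrank_eq (t : ℝ) : Module.finrank ℝ (InterpolatedPlane t) = 2 := by
  rw [(coord t).finrank_eq]; simp

instance (t : ℝ) : FiniteDimensional ℝ (InterpolatedPlane t) :=
  Module.finite_of_finrank_eq_succ (finrank_eq t)

instance (t : ℝ) : CompleteSpace (InterpolatedPlane t) := FiniteDimensional.complete ℝ _

instance (t : ℝ) : Nontrivial (InterpolatedPlane t) :=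
  Module.nontrivial_of_finrank_eq_succ (finrank_eq t)

theorem norm_pi_le_norm_euclidean (x : Fin 2 → ℝ) : ‖x‖ ≤ ‖WithLp.toLp 2 x‖ :=
  (pi_norm_le_iff_of_nonneg (norm_nonneg _)).2 fun i => PiLp.norm_apply_le (WithLp.toLp 2 x) i

theorem norm_euclidean_le_two_mul (x : Fin 2 → ℝ) : ‖WithLp.toLp 2 x‖ ≤ 2 * ‖x‖ := by
  rw [EuclideanSpace.norm_eq]
  refine Real.sqrt_le_iff.2 ⟨by positivity, ?_⟩
  have h : ∀ i, ‖x i‖ ^ 2 ≤ ‖x‖ ^ 2 := fun i => by gcongr; exact norm_le_pi_norm x i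
  simp only [Fin.sum_univ_two]
  nlinarith [h 0, h 1, sq_nonneg ‖x‖]

/-- The identity between two planes with interpolated norms. -/
noncomputable def changeParam (s t : ℝ) : InterpolatedPlane s ≃L[ℝ] InterpolatedPlane t :=
  ((coord s).trans (coord t).symm).toContinuousLinearEquiv

/-- With $p,q$ the Euclidean and sup norms, the two interpolated norms differ by $(s-t)(p-q)$, and
$0\le p-q\le q$. Only one of the two directions can increase norms. -/
theorem norm_changeParam_mul_le {s t : ℝ} (hs : s ∈ Set.Icc (0 : ℝ) 1)
    (ht : t ∈ Set.Icc (0 : ℝ) 1) :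
    ‖(changeParam s t : InterpolatedPlane s →L[ℝ] InterpolatedPlane t)‖ *
      ‖((changeParam s t).symm : InterpolatedPlane t →L[ℝ] InterpolatedPlane s)‖ ≤
        1 + |s - t| := by
  have key : ∀ s ∈ Set.Icc (0 : ℝ) 1, ∀ t ∈ Set.Icc (0 : ℝ) 1,
      ‖(changeParam s t : InterpolatedPlane s →L[ℝ] InterpolatedPlane t)‖ ≤
        1 + max 0 (s - t) := by
    intro s hs t ht
    refine ContinuousLinearMap.opNorm_le_bound _ (by positivity) fun x => ?_
    change ‖changeParam s t x‖ ≤ _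
    rw [norm_eq, norm_eq]
    have e : coord t (changeParam s t x) = coord s x := rfl
    rw [e, abs_of_nonneg hs.1, abs_of_nonneg ht.1, abs_of_nonneg (sub_nonneg.2 hs.2),
      abs_of_nonneg (sub_nonneg.2 ht.2)]
    set p := ‖WithLp.toLp 2 (coord s x)‖
    set q := ‖coord s x‖
    have h1 : q ≤ p := norm_pi_le_norm_euclidean _
    have h2 : p ≤ 2 * q := norm_euclidean_le_two_mul _
    have hq : 0 ≤ q := norm_nonneg _
    have h3 : (s - t) * (p - q) ≤ max 0 (s - t) * q :=
      (mul_le_mul_of_nonneg_right (le_max_right 0 _) (by linarith)).trans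
        (mul_le_mul_of_nonneg_left (by linarith) (le_max_left _ _))
    have h4 : max 0 (s - t) * q ≤ max 0 (s - t) * ((1 - s) * p + s * q) :=
      mul_le_mul_of_nonneg_left (by nlinarith [mul_le_mul_of_nonneg_left h1 (sub_nonneg.2 hs.2)])
        (le_max_left _ _)
    nlinarith
  have k1 := key s hs t ht
  have k2 : ‖((changeParam s t).symm : InterpolatedPlane t →L[ℝ] InterpolatedPlane s)‖ ≤
      1 + max 0 (t - s) := key t ht s hs
  refine (mul_le_mul k1 k2 (norm_nonneg _) (by positivity)).trans ?_
  rcases le_total s t with h | h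
  · rw [max_eq_left (sub_nonpos.2 h), max_eq_right (sub_nonneg.2 h), abs_of_nonpos (sub_nonpos.2 h)]
    linarith
  · rw [max_eq_right (sub_nonneg.2 h), max_eq_left (sub_nonpos.2 h), abs_of_nonneg (sub_nonneg.2 h)]
    linarith

theorem continuousOn_numIndex :
    ContinuousOn (fun t => numIndex (InterpolatedPlane t)) (Set.Icc 0 1) := by
  intro s hs
  refine Metric.continuousWithinAt_iff.2 fun ε hε => ?_
  -- The radius $a^2$ matches the hypothesis of `numIndex_le_add_of_equiv`, and
  -- $15a\le\varepsilon/2$.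
  set a := min (1 / 2) (ε / 30) with ha
  have ha0 : 0 < a := by positivity
  have ha2 : a ≤ 1 / 2 := min_le_left _ _
  have ha3 : a ≤ ε / 30 := min_le_right _ _
  refine ⟨a ^ 2, by positivity, fun t ht hts => ?_⟩
  rw [Real.dist_eq] at hts ⊢
  have h1 := numIndex_le_add_of_equiv (changeParam s t) ha0 ha2
    ((norm_changeParam_mul_le hs ht).trans (by rw [abs_sub_comm]; linarith))
  have h2 := numIndex_le_add_of_equiv (changeParam t s) ha0 ha2
    ((norm_changeParam_mul_le ht hs).trans (by linarith))
  exact abs_lt.2 ⟨by linarith, by linarith⟩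

theorem numIndex_euclideanPlane : numIndex (EuclideanSpace ℝ (Fin 2)) = 0 :=
  numIndex_eq_zero_of_numRadius_eq_zero planeRotation_ne_zero
    (numRadius_eq_zero_of_inner_eq_zero inner_planeRotation)

theorem numIndex_zero : numIndex (InterpolatedPlane 0) ≤ 0 :=
  (numIndex_le_of_linearIsometryEquiv (X := EuclideanSpace ℝ (Fin 2))
    { (WithLp.linearEquiv 2 ℝ (Fin 2 → ℝ)).trans (coord 0).symm with
      norm_map' := fun x => by
        change ‖(coord 0).symm (WithLp.ofLp x)‖ = ‖x‖
        rw [norm_eq]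
        simp }).trans_eq numIndex_euclideanPlane

/-- Each row of $T$ is maximized over the unit ball at a sign vector $s$, and $s_i$ times the $i$-th
coordinate functional is a norm-one functional with value 1 at $s$. Hence $\|T\|\le v(T)$. -/
theorem one_le_numIndex_pi {ι : Type*} [Fintype ι] [Nonempty ι] : 1 ≤ numIndex (ι → ℝ) := by
  classical
  refine le_numIndex fun T hT => ?_
  rw [← hT]
  refine ContinuousLinearMap.opNorm_le_of_unit_norm (numRadius_nonneg T) fun x hx => ?_
  refine (pi_norm_le_iff_of_nonneg (numRadius_nonneg T)).2 fun i => ?_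
  set a : ι → ℝ := fun j => T (Pi.single j 1) i with ha
  have hT : ∀ z : ι → ℝ, T z i = ∑ j, z j * a j := by
    intro z
    nth_rw 1 [pi_eq_sum_univ' z]
    simp [ha, Finset.sum_apply]
  -- Zero entries get sign 1, so that $|s_j|=1$ for every $j$, in particular for $j=i$.
  set s : ι → ℝ := fun j => if 0 ≤ a j then 1 else -1 with hs
  have hsa : ∀ j, |s j| = 1 := fun j => by
    simp only [hs]; split_ifs <;> simp
  have hsn : ‖s‖ = 1 := by
    refine le_antisymm ((pi_norm_le_iff_of_nonneg zero_le_one).2 fun j => (hsa j).le) ?_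
    rw [← hsa i]
    exact norm_le_pi_norm s i
  have hle : ‖T x i‖ ≤ T s i := by
    rw [hT, hT]
    refine (norm_sum_le _ _).trans (Finset.sum_le_sum fun j _ => ?_)
    have h1 : s j * a j = |a j| := by
      simp only [hs]
      split_ifs with h
      · rw [one_mul, abs_of_nonneg h]
      · rw [abs_of_neg (not_le.1 h)]; ring
    rw [h1, norm_mul, Real.norm_eq_abs (a j)]
    exact mul_le_of_le_one_left (abs_nonneg _) (hx ▸ norm_le_pi_norm x j)
  have hss : s i * s i = 1 := by rw [← abs_mul_abs_self, hsa, one_mul]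
  set f : StrongDual ℝ (ι → ℝ) := s i • ContinuousLinearMap.proj (R := ℝ) (φ := fun _ : ι => ℝ) i
    with hf
  have hfz : ∀ z, f z = s i * z i := fun z => rfl
  have hf1 : ‖f‖ = 1 := by
    apply le_antisymm
    · refine ContinuousLinearMap.opNorm_le_bound _ zero_le_one fun z => ?_
      rw [hfz, norm_mul, Real.norm_eq_abs (s i), hsa]
      exact mul_le_mul_of_nonneg_left (norm_le_pi_norm z i) zero_le_one
    · have := f.le_opNorm s
      rwa [hfz, hss, hsn, norm_one, mul_one] at this
  have := abs_apply_le_numRadius T hsn hf1 ((hfz s).trans hss)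
  rw [hfz, abs_mul, hsa, one_mul] at this
  exact hle.trans ((le_abs_self _).trans this)

theorem one_le_numIndex_one : 1 ≤ numIndex (InterpolatedPlane 1) :=
  one_le_numIndex_pi.trans <| numIndex_le_of_linearIsometryEquiv
    { coord 1 with
      norm_map' := fun x => by
        change ‖coord 1 x‖ = ‖x‖
        rw [norm_eq]
        simp }

theorem exists_numIndex_eq {θ : ℝ} (h0 : 0 ≤ θ) (h1 : θ ≤ 1) :
    ∃ t, numIndex (InterpolatedPlane t) = θ := by
  obtain ⟨t, -, ht⟩ := intermediate_value_Icc zero_le_one continuousOn_numIndex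
    ⟨numIndex_zero.trans h0, h1.trans one_le_numIndex_one⟩
  exact ⟨t, ht⟩

end InterpolatedPlane

end Plane

/-! ### Infinite $\ell_\infty$-sums and the case $\theta=0$. -/

section LpSum

variable {ι : Type*} [DecidableEq ι] {E : ι → Type*} [∀ i, NormedAddCommGroup (E i)]
  [∀ i, NormedSpace ℝ (E i)]

theorem isMSummand_lp (i : ι) :
    IsMSummand (lp.singleContinuousLinearMap (𝕜 := ℝ) E ∞ i) (lp.evalCLM ℝ E ∞ i) where
  proj_incl y := lp.single_apply_self ∞ i y
  norm_eq x := by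
    change ‖x‖ = max ‖x i‖ ‖x - lp.single ∞ i (x i)‖
    apply le_antisymm
    · refine lp.norm_le_of_forall_le (by positivity) fun j => ?_
      rcases eq_or_ne j i with rfl | hj
      · exact le_max_left _ _
      · refine le_max_of_le_right ?_
        have := lp.norm_apply_le_norm ENNReal.top_ne_zero (x - lp.single ∞ i (x i)) j
        rwa [lp.coeFn_sub, Pi.sub_apply, lp.single_apply_ne _ _ _ hj, sub_zero] at this
    · refine max_le (lp.norm_apply_le_norm ENNReal.top_ne_zero x i) ?_
      refine lp.norm_le_of_forall_le (norm_nonneg _) fun j => ?_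
      rw [lp.coeFn_sub, Pi.sub_apply]
      rcases eq_or_ne j i with rfl | hj
      · rw [lp.single_apply_self, sub_self, norm_zero]; exact norm_nonneg _
      · rw [lp.single_apply_ne _ _ _ hj, sub_zero]
        exact lp.norm_apply_le_norm ENNReal.top_ne_zero x j

end LpSum

/-- Every plane in the sum is an M-summand with index $1/(k+1)>0$, so it bounds both indices of the
sum; positivity is what the bound on $n'$ requires. -/
theorem exists_numIndex_eq_zero_secondNumIndex_eq_zero :
    ∃ (X : Type) (_ : NormedAddCommGroup X) (_ : NormedSpace ℝ X),
      CompleteSpace X ∧ Nontrivial X ∧ numIndex X = 0 ∧ secondNumIndex X = 0 := by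
  have h : ∀ k : ℕ, ∃ t, numIndex (InterpolatedPlane t) = 1 / ((k : ℝ) + 1) := fun k =>
    InterpolatedPlane.exists_numIndex_eq (by positivity)
      ((div_le_one (by positivity)).2 (by linarith [Nat.cast_nonneg (α := ℝ) k]))
  choose t ht using h
  have hM := fun k => isMSummand_lp (E := fun k => InterpolatedPlane (t k)) k
  have hsmall : ∀ {a : ℝ}, 0 ≤ a → (∀ k : ℕ, a ≤ 1 / ((k : ℝ) + 1)) → a = 0 := by
    refine fun h0 ha => le_antisymm (le_of_forall_pos_le_add fun ε hε => ?_) h0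
    obtain ⟨k, hk⟩ := exists_nat_one_div_lt hε
    linarith [ha k]
  refine ⟨lp (fun k => InterpolatedPlane (t k)) ∞, inferInstance, inferInstance, inferInstance,
    ?_, ?_, ?_⟩
  · obtain ⟨y, hy⟩ := exists_ne (0 : InterpolatedPlane (t 0))
    refine ⟨lp.single ∞ 0 y, 0, fun h0 => hy ?_⟩
    rw [← norm_eq_zero, ← (hM 0).norm_incl y]
    exact norm_eq_zero.2 h0
  · exact hsmall numIndex_nonneg fun k => ht k ▸ (hM k).numIndex_le
  · exact hsmall secondNumIndex_nonneg fun k =>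
      ht k ▸ (hM k).secondNumIndex_le (by rw [ht k]; positivity)

theorem mainTheorem8 :
    (∀ θ ∈ Set.Icc (0 : ℝ) (1 / 2),
      ∃ (X : Type) (_ : NormedAddCommGroup X) (_ : NormedSpace ℝ X),
        CompleteSpace X ∧ Nontrivial X ∧ numIndex X = 0 ∧ secondNumIndex X = θ) ∧
    (∀ θ ∈ Set.Ioc (0 : ℝ) (1 / 2),
      (∃ (Y : Type) (_ : NormedAddCommGroup Y) (_ : NormedSpace ℝ Y),
        Module.finrank ℝ Y = 2 ∧ numIndex Y = θ) ∧
      (∀ (Y : Type*) [NormedAddCommGroup Y] [NormedSpace ℝ Y],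
        Module.finrank ℝ Y = 2 → numIndex Y = θ →
          Module.finrank ℝ (WithLp ∞ (Y × EuclideanSpace ℝ (Fin 2))) = 4 ∧
          numIndex (WithLp ∞ (Y × EuclideanSpace ℝ (Fin 2))) = 0 ∧
          secondNumIndex (WithLp ∞ (Y × EuclideanSpace ℝ (Fin 2))) = θ)) := by
  refine ⟨fun θ hθ => ?_, fun θ hθ => ⟨?_, fun Y _ _ hY hn => ⟨?_, ?_, ?_⟩⟩⟩
  · rcases hθ.1.eq_or_lt with rfl | hpos
    · exact exists_numIndex_eq_zero_secondNumIndex_eq_zero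
    obtain ⟨t, rfl⟩ := InterpolatedPlane.exists_numIndex_eq hθ.1 (hθ.2.trans (by norm_num))
    exact ⟨WithLp ∞ (InterpolatedPlane t × EuclideanSpace ℝ (Fin 2)), inferInstance, inferInstance,
      inferInstance, inferInstance, numIndex_withLp_prod_eq_zero planeRotation_ne_zero
        inner_planeRotation, secondNumIndex_withLp_prod hpos hθ.2⟩
  · obtain ⟨t, ht⟩ := InterpolatedPlane.exists_numIndex_eq hθ.1.le (hθ.2.trans (by norm_num))
    exact ⟨InterpolatedPlane t, inferInstance, inferInstance, InterpolatedPlane.finrank_eq t, ht⟩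
  · have := Module.finite_of_finrank_eq_succ hY
    rw [(WithLp.linearEquiv ∞ ℝ (Y × EuclideanSpace ℝ (Fin 2))).finrank_eq, Module.finrank_prod, hY,
      finrank_euclideanSpace_fin]
  · exact numIndex_withLp_prod_eq_zero planeRotation_ne_zero inner_planeRotation
  · have := Module.nontrivial_of_finrank_eq_succ hY
    subst hn
    exact secondNumIndex_withLp_prod hθ.1 hθ.2
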